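/- Let $\beta=(\beta_w)_{|w|\le 4}$ be a sequence of real numbers indexed by the words $w$ of length at most $4$ in two noncommuting letters $X,Y$, with $\beta_v=\beta_w$ whenever $v$ is a cyclic permutation of $w$, and $\beta_w=\beta_{w^*}$, where $w^*$ is the reverse of $w$. Assume that $\beta$ is normalized ($\beta_1=1$) and noncommutative ($\beta_{X^2Y^2}\ne\beta_{XYXY}$). Let $\mathcal M_2=(\beta_{U^*V})_{|U|,|V|\le 2}$ be its $7\times 7$ moment matrix, with rows and columns indexed by the words $1,X,Y,X^2,XY,YX,Y^2$, and write $\mathbb X^2,\mathbb{XY},\mathbb{YX},\mathbb Y^2$ for the columns indexed by $X^2,XY,YX,Y^2$. A representing measure of $\beta$ consists of finitely many pairs $(A_i,B_i)$ of real symmetric $t_i\times t_i$ matrices, $t_i\ge 1$ (the atoms, of size $t_i$), and densities $\lambda_i>0$ with $\sum_i\lambda_i=1$, such that $\beta_w=\sum_i\lambda_i\frac1{t_i}\operatorname{tr} w(A_i,B_i)$ for all $|w|\le 4$. Its type is $(m_1,\dots,m_r)$ if it has exactly $m_k$ atoms of size $k$ for $1\le k\le r$, none of size greater than $r$, and $m_r\neq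 0$. It is minimal if $\beta$ has no representing measure of a type $(m_1',\dots,m_{r'}')$ with $r'<r$, or with $r'=r$ and $m_k'<m_k$ at the largest $k$ for which $m_k'\ne m_k$. The sequence $\beta$ admits an nc measure if it has a minimal representing measure of a type $(m_1,\dots,m_r)$ with $r>1$. Two representing measures are orthogonally equivalent if, after renumbering the atoms, the densities agree and each atom $(A_i,B_i)$ of the first corresponds to an atom $(U_iA_iU_i^t,U_iB_iU_i^t)$ of the second with $U_i$ orthogonal. Theorem. Suppose that $\mathcal M_2$ has rank $5$ and satisfies the column relations $\mathbb{XY}+\mathbb{YX}=\mathbf 0$ and $\mathbb X^2=\mathbb Y^2$. Then $\beta$ admits an nc measure if and only if $\mathcal M_2$ is positive semidefinite and $\beta_X=\beta_Y=0$. In that case the minimal representing measure is unique up to orthogonal equivalence, and it is of type $(1,1)$. -/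

import Mathlib

namespace BQTMP

/-- The two noncommuting letters. -/
inductive Letter
  | X
  | Y

/-- Words in the letters `X, Y` of length at most `n`. A word is the list of its letters: the product
of words is `++`, the involution is `List.reverse`, the empty word is `[]`, and cyclic equivalence
is `List.IsRotated`, written `~r`. -/
abbrev Word (n : ℕ) : Type := {w : List Letter // w.length ≤ n}

/-- A real sequence `β = (β_w)`, indexed by the words of length at most `4`, that is invariant under
cyclic equivalence and under the involution. -/
structure TracialSeq where
  val : Word 4 → ℝ
  cyclic : ∀ v w : Word 4, v.1 ~r w.1 → val v = val w
  star : ∀ v w : Word 4, w.1 = v.1.reverse → val v = val w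

/-- The moment `β_w`. -/
def TracialSeq.moment (β : TracialSeq) (w : List Letter) (h : w.length ≤ 4 := by decide) : ℝ :=
  β.val ⟨w, h⟩

/-- `β` is normalized: `β_1 = 1`. -/
def TracialSeq.Normalized (β : TracialSeq) : Prop :=
  β.moment [] = 1

/-- `β` is a noncommutative sequence: `β_{X²Y²} ≠ β_{XYXY}`. -/
def TracialSeq.Noncommutative (β : TracialSeq) : Prop :=
  β.moment [.X, .X, .Y, .Y] ≠ β.moment [.X, .Y, .X, .Y]

/-- The words of length at most two, in degree-lexicographic order. -/
def basisWord : Fin 7 → Word 2 :=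
  ![⟨[], by decide⟩, ⟨[.X], by decide⟩, ⟨[.Y], by decide⟩, ⟨[.X, .X], by decide⟩,
    ⟨[.X, .Y], by decide⟩, ⟨[.Y, .X], by decide⟩, ⟨[.Y, .Y], by decide⟩]

/-- The word `u* v`. -/
def starMul (u v : Word 2) : Word 4 :=
  ⟨u.1.reverse ++ v.1, by
    have hu := u.2
    have hv := v.2
    simp only [List.length_append, List.length_reverse]
    omega⟩

/-- The truncated moment matrix `M₂(β)`: the entry in row `U` and column `V` is `β_{U* V}`. -/
def TracialSeq.momentMatrix (β : TracialSeq) : Matrix (Fin 7) (Fin 7) ℝ :=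
  Matrix.of fun i j => β.val (starMul (basisWord i) (basisWord j))

/-- The column of `M₂(β)` that is indexed by the word `w`. -/
def TracialSeq.column (β : TracialSeq) (w : List Letter) (h : w.length ≤ 2 := by decide) :
    Fin 7 → ℝ :=
  fun i => β.val (starMul (basisWord i) ⟨w, h⟩)

/-- An atom: a pair of real symmetric matrices of the same positive size. -/
structure Atom where
  size : ℕ
  size_pos : 0 < size
  A : Matrix (Fin size) (Fin size) ℝ
  B : Matrix (Fin size) (Fin size) ℝ
  A_symm : A.IsSymm
  B_symm : B.IsSymm

/-- The matrix substituted for a letter. -/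
def Atom.letter (a : Atom) : Letter → Matrix (Fin a.size) (Fin a.size) ℝ
  | .X => a.A
  | .Y => a.B

/-- The matrix `w(A, B)`. -/
def Atom.eval (a : Atom) (w : List Letter) : Matrix (Fin a.size) (Fin a.size) ℝ :=
  (w.map a.letter).prod

/-- The normalized trace of `w(A, B)`. -/
noncomputable def Atom.normTrace (a : Atom) (w : List Letter) : ℝ :=
  (a.eval w).trace / (a.size : ℝ)

/-- Two atoms are orthogonally equivalent if an orthogonal matrix conjugates one pair into the other.
(The two conditions on `U` force the sizes to agree.) -/
def Atom.OrthEquiv (a b : Atom) : Prop :=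
  ∃ U : Matrix (Fin b.size) (Fin a.size) ℝ,
    U.transpose * U = 1 ∧ U * U.transpose = 1 ∧
      b.A = U * a.A * U.transpose ∧ b.B = U * a.B * U.transpose

/-- Finitely many atoms with positive densities that sum to `1`. -/
structure AtomicMeasure where
  N : ℕ
  density : Fin N → ℝ
  density_pos : ∀ i, 0 < density i
  density_sum : ∑ i, density i = 1
  atom : Fin N → Atom

namespace AtomicMeasure

/-- `μ` represents `β`. -/
def Represents (μ : AtomicMeasure) (β : TracialSeq) : Prop :=
  ∀ w : Word 4, β.val w = ∑ i, μ.density i * (μ.atom i).normTrace w.1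

/-- The number of atoms of size `k`. -/
def numAtoms (μ : AtomicMeasure) (k : ℕ) : ℕ :=
  (Finset.univ.filter fun i => (μ.atom i).size = k).card

/-- The largest size of an atom. -/
def maxSize (μ : AtomicMeasure) : ℕ :=
  Finset.univ.sup fun i => (μ.atom i).size

/-- The type `(m₁, …, m_r)`: there are exactly `m_k` atoms of size `k`, and `r` is the largest size
of an atom. -/
def type (μ : AtomicMeasure) : List ℕ :=
  (List.range μ.maxSize).map fun k => μ.numAtoms (k + 1)

/-- The type of `μ` is strictly smaller than the type of `ν`: the largest size is smaller, or the
largest sizes agree and, at the largest size at which the numbers of atoms differ, `μ` has fewer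
atoms. -/
def Smaller (μ ν : AtomicMeasure) : Prop :=
  μ.maxSize < ν.maxSize ∨
    (μ.maxSize = ν.maxSize ∧ ∃ k, μ.numAtoms k < ν.numAtoms k ∧
      ∀ l, k < l → μ.numAtoms l = ν.numAtoms l)

/-- `μ` is a minimal representing measure of `β`. -/
def IsMinimal (μ : AtomicMeasure) (β : TracialSeq) : Prop :=
  μ.Represents β ∧ ¬ ∃ ν : AtomicMeasure, ν.Represents β ∧ ν.Smaller μ

/-- Orthogonal equivalence of measures: up to the enumeration of the atoms, the densities are equal
and the atoms are orthogonally equivalent. -/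
def OrthEquiv (μ ν : AtomicMeasure) : Prop :=
  ∃ e : Fin μ.N ≃ Fin ν.N, ∀ i,
    ν.density (e i) = μ.density i ∧ (μ.atom i).OrthEquiv (ν.atom (e i))

end AtomicMeasure

/-- `β` admits a noncommutative measure: it admits a minimal measure of type `(m₁, …, m_r)` with
`r > 1`. -/
def TracialSeq.AdmitsNcMeasure (β : TracialSeq) : Prop :=
  ∃ μ : AtomicMeasure, μ.IsMinimal β ∧ 1 < μ.maxSize

end BQTMP

/-! For a representing measure, the quadratic form of the moment matrix at a polynomial `P` is the
weighted sum of the normalized traces of `PᵀP` over the atoms. Hence the matrix is positive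
semidefinite, and each column relation passes to every atom: `AB + BA = 0` and `A² = B²`. These
identities force `tr A = tr B = 0` in every size, whence `β_X = β_Y = 0`.

Conversely, the relations leave only `β_X`, `β_Y`, `a = β_{X²}` and `c = β_{X⁴}` free. Rank five
leaves no further relations, so positivity is strict off their span: `a > 0` and `c > a²`. A zero
atom and a pair of orthogonal reflections scaled by `r`, with densities `1 - l` and `l`, then
represent `β` as soon as `l r² = a` and `l r⁴ = c`.

Nothing smaller works: an atom of size one is `(0, 0)`, so `c ≠ 0` needs a larger atom, and a single
atom of size two alone would give `c = a²`. In type `(1, 1)` the moments determine `l` and `r`, and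
in size two the relations determine the pair up to scale and orthogonal conjugation. -/

namespace BQTMP

open Matrix

/-! ### Anticommuting symmetric matrices with equal squares -/

/-- If `A` anticommutes with `B` and `A² = B²`, then the trace of the symmetric matrix `A`
vanishes. With `D` the pseudo-inverse of `A²`, one has `A = B² D A`, and the trace of `B² D A`
equals its own negative. -/
theorem trace_eq_zero_of_anticommute {n : Type*} [Fintype n] [DecidableEq n] {A B : Matrix n n ℝ}
    (hA : A.IsSymm) (hAB : A * B + B * A = 0) (hsq : A * A = B * B) : A.trace = 0 := by
  set S := A * A with hS
  have hSsa : IsSelfAdjoint S := by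
    rw [isSelfAdjoint_iff, hS, star_mul]
    simp [star_eq_conjTranspose, conjTranspose_eq_transpose_of_trivial, hA.eq]
  -- As `0⁻¹ = 0`, this inverts `S` on its range and is zero on its kernel; `S` may be singular.
  set D := cfc (fun x : ℝ => x⁻¹) S with hD
  have hcont : ContinuousOn (fun x : ℝ => x⁻¹) (spectrum ℝ S) :=
    Matrix.finite_real_spectrum.continuousOn _
  have hSDS : S * D * S = S := by
    have h1 : cfc (fun x : ℝ => x * x⁻¹ * x) S =
        cfc (fun x : ℝ => x) S * D * cfc (fun x : ℝ => x) S := by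
      rw [cfc_mul (fun x : ℝ => x * x⁻¹) (fun x => x) S
          (Matrix.finite_real_spectrum.continuousOn _) continuousOn_id,
        cfc_mul (fun x : ℝ => x) (fun x => x⁻¹) S continuousOn_id hcont]
    have h2 : (fun x : ℝ => x * x⁻¹ * x) = fun x => x := by
      funext x
      exact mul_inv_mul_cancel x
    rw [h2, cfc_id' ℝ S] at h1
    exact h1.symm
  have hDA : D * A = A * D :=
    Commute.cfc_real (show Commute S A by simp [Commute, SemiconjBy, hS, mul_assoc]) _
  have hDB : D * B = B * D :=
    Commute.cfc_real (show Commute S B by simp [Commute, SemiconjBy, hsq, mul_assoc]) _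
  have hDS : D * S = S * D := by
    rw [hS, ← mul_assoc, hDA, mul_assoc, hDA, mul_assoc]
  have hDsa : Dᴴ = D := (cfc_predicate (fun x : ℝ => x⁻¹) S : IsSelfAdjoint D)
  have hAh : Aᴴ = A := by rw [conjTranspose_eq_transpose_of_trivial, hA.eq]
  have hSh : Sᴴ = S := hSsa
  have hSA : S * A = A * S := by rw [hS, mul_assoc]
  have hSE : S * (S * D - 1) = 0 := by
    rw [mul_sub, ← hDS, ← mul_assoc, hSDS, mul_one, sub_self]
  have hEA : (S * D - 1) * A = A * (S * D - 1) := by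
    rw [sub_mul, mul_sub, mul_assoc, hDA, ← mul_assoc, hSA, mul_assoc, one_mul, mul_one]
  -- With `E = S D - 1`, which commutes with `A` and satisfies `S E = 0`, one gets `(E A)ᴴ (E A) = S
  -- E E = 0`.
  have hN : (S * D - 1) * A = 0 := by
    rw [← trace_conjTranspose_mul_self_eq_zero_iff, conjTranspose_mul, conjTranspose_sub,
      conjTranspose_mul, hDsa, hSh, hAh, conjTranspose_one, hDS]
    have : A * (S * D - 1) * ((S * D - 1) * A) = S * (S * D - 1) * (S * D - 1) := by
      rw [hEA, mul_assoc, ← mul_assoc _ A, hEA, ← mul_assoc, ← mul_assoc]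
    rw [this, hSE, zero_mul, trace_zero]
  have hAeq : A = B * (B * D * A) := by
    rw [sub_mul, one_mul, sub_eq_zero] at hN
    rw [← mul_assoc, ← mul_assoc, ← hsq, hN]
  have hBA : A * B = -(B * A) := eq_neg_of_add_eq_zero_left hAB
  -- Cyclicity moves the first `B` to the end; bringing it back past `A` costs a sign, past `D`
  -- nothing.
  have h1 : (B * (B * D * A)).trace = -(B * (B * D * A)).trace := by
    conv_lhs => rw [trace_mul_comm]
    rw [mul_assoc, hBA, ← trace_neg, mul_neg, mul_assoc B D, ← mul_assoc D B A, hDB,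
      mul_assoc B D A]
  rw [hAeq]
  linarith

/-! ### Symmetries of moments and of traces -/

/-- One representative for each cyclic class of words of length at most four. -/
def necklaces : List (List Letter) :=
  [[], [.X], [.Y], [.X, .X], [.X, .Y], [.Y, .Y], [.X, .X, .X], [.X, .X, .Y], [.X, .Y, .Y],
    [.Y, .Y, .Y], [.X, .X, .X, .X], [.X, .X, .X, .Y], [.X, .X, .Y, .Y], [.X, .Y, .X, .Y],
    [.X, .Y, .Y, .Y], [.Y, .Y, .Y, .Y]]

instance : DecidableEq Letter
  | .X, .X => isTrue rfl
  | .X, .Y => isFalse nofun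
  | .Y, .X => isFalse nofun
  | .Y, .Y => isTrue rfl

theorem exists_necklace (w : List Letter) (hw : w.length ≤ 4) : ∃ v ∈ necklaces, v ~r w := by
  match w, hw with
  | [], _ => decide
  | [a], _ => cases a <;> decide
  | [a, b], _ => cases a <;> cases b <;> decide
  | [a, b, c], _ => cases a <;> cases b <;> cases c <;> decide
  | [a, b, c, d], _ => cases a <;> cases b <;> cases c <;> cases d <;> decide
  | _ :: _ :: _ :: _ :: _ :: _, h => simp at h; omega

theorem length_le_of_mem_necklaces : ∀ w ∈ necklaces, w.length ≤ 4 := by decide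

namespace Atom

theorem eval_append (a : Atom) (u v : List Letter) : a.eval (u ++ v) = a.eval u * a.eval v := by
  simp [eval]

theorem letter_transpose (a : Atom) (l : Letter) : (a.letter l)ᵀ = a.letter l := by
  cases l
  · exact a.A_symm
  · exact a.B_symm

theorem eval_reverse (a : Atom) (w : List Letter) : a.eval w.reverse = (a.eval w)ᵀ := by
  induction w with
  | nil => simp [eval]
  | cons l w ih =>
    rw [List.reverse_cons, eval_append, ih]
    simp [eval, letter_transpose]

theorem normTrace_eq_of_isRotated (a : Atom) {v w : List Letter} (h : v ~r w) :
    a.normTrace v = a.normTrace w := by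
  obtain ⟨n, rfl⟩ := h
  rw [normTrace, normTrace, List.rotate_eq_drop_append_take_mod, eval_append, trace_mul_comm,
    ← eval_append, List.take_append_drop]

end Atom

theorem AtomicMeasure.represents_of_necklaces {μ : AtomicMeasure} {β : TracialSeq}
    (h : ∀ w (hw : w ∈ necklaces),
      β.moment w (length_le_of_mem_necklaces w hw) = ∑ i, μ.density i * (μ.atom i).normTrace w) :
    μ.Represents β := by
  intro w
  obtain ⟨v, hv, hvw⟩ := exists_necklace w.1 w.2
  rw [← β.cyclic ⟨v, length_le_of_mem_necklaces v hv⟩ w hvw]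
  refine (h v hv).trans (Finset.sum_congr rfl fun i _ => ?_)
  rw [(μ.atom i).normTrace_eq_of_isRotated hvw]

/-! ### The moments of the sequence -/

/-- The moments that are not determined to vanish by the relations `XY + YX = 0` and `X² = Y²` are
`β_X`, `β_Y`, `β_{X²} = a` and `β_{X⁴} = c`. -/
structure TracialSeq.HasMoments (β : TracialSeq) (a c : ℝ) : Prop where
  one : β.moment [] = 1
  XX : β.moment [.X, .X] = a
  XY : β.moment [.X, .Y] = 0
  YY : β.moment [.Y, .Y] = a
  XXX : β.moment [.X, .X, .X] = 0
  XXY : β.moment [.X, .X, .Y] = 0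
  XYY : β.moment [.X, .Y, .Y] = 0
  YYY : β.moment [.Y, .Y, .Y] = 0
  XXXX : β.moment [.X, .X, .X, .X] = c
  XXXY : β.moment [.X, .X, .X, .Y] = 0
  XXYY : β.moment [.X, .X, .Y, .Y] = c
  XYXY : β.moment [.X, .Y, .X, .Y] = -c
  XYYY : β.moment [.X, .Y, .Y, .Y] = 0
  YYYY : β.moment [.Y, .Y, .Y, .Y] = c

/-- Each row of a column relation is a linear equation between moments. Modulo cyclic invariance,
many have the form `2β_w = 0`, and the row of `XY` gives `β_{XYXY} = -β_{X²Y²}`. -/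
theorem TracialSeq.hasMoments {β : TracialSeq} (hnorm : β.Normalized)
    (hXY : β.column [.X, .Y] + β.column [.Y, .X] = 0)
    (hXX : β.column [.X, .X] = β.column [.Y, .Y]) :
    β.HasMoments (β.moment [.X, .X]) (β.moment [.X, .X, .X, .X]) := by
  have r0 : β.moment [.X, .Y] + β.moment [.Y, .X] = 0 := congrFun hXY 0
  have r1 : β.moment [.X, .X, .Y] + β.moment [.X, .Y, .X] = 0 := congrFun hXY 1
  have r2 : β.moment [.Y, .X, .Y] + β.moment [.Y, .Y, .X] = 0 := congrFun hXY 2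
  have r3 : β.moment [.X, .X, .X, .Y] + β.moment [.X, .X, .Y, .X] = 0 := congrFun hXY 3
  have r4 : β.moment [.Y, .X, .X, .Y] + β.moment [.Y, .X, .Y, .X] = 0 := congrFun hXY 4
  have r6 : β.moment [.Y, .Y, .X, .Y] + β.moment [.Y, .Y, .Y, .X] = 0 := congrFun hXY 6
  have s0 : β.moment [.X, .X] = β.moment [.Y, .Y] := congrFun hXX 0
  have s1 : β.moment [.X, .X, .X] = β.moment [.X, .Y, .Y] := congrFun hXX 1
  have s2 : β.moment [.Y, .X, .X] = β.moment [.Y, .Y, .Y] := congrFun hXX 2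
  have s3 : β.moment [.X, .X, .X, .X] = β.moment [.X, .X, .Y, .Y] := congrFun hXX 3
  have s6 : β.moment [.Y, .Y, .X, .X] = β.moment [.Y, .Y, .Y, .Y] := congrFun hXX 6
  have c0 : β.moment [.Y, .X] = β.moment [.X, .Y] := β.cyclic _ _ ⟨1, rfl⟩
  have c1 : β.moment [.X, .Y, .X] = β.moment [.X, .X, .Y] := β.cyclic _ _ ⟨2, rfl⟩
  have c2 : β.moment [.Y, .X, .Y] = β.moment [.X, .Y, .Y] := β.cyclic _ _ ⟨1, rfl⟩
  have c3 : β.moment [.Y, .Y, .X] = β.moment [.X, .Y, .Y] := β.cyclic _ _ ⟨2, rfl⟩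
  have c4 : β.moment [.X, .X, .Y, .X] = β.moment [.X, .X, .X, .Y] := β.cyclic _ _ ⟨3, rfl⟩
  have c5 : β.moment [.Y, .X, .X, .Y] = β.moment [.X, .X, .Y, .Y] := β.cyclic _ _ ⟨1, rfl⟩
  have c6 : β.moment [.Y, .X, .Y, .X] = β.moment [.X, .Y, .X, .Y] := β.cyclic _ _ ⟨1, rfl⟩
  have c7 : β.moment [.Y, .Y, .X, .Y] = β.moment [.X, .Y, .Y, .Y] := β.cyclic _ _ ⟨2, rfl⟩
  have c8 : β.moment [.Y, .Y, .Y, .X] = β.moment [.X, .Y, .Y, .Y] := β.cyclic _ _ ⟨3, rfl⟩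
  have c9 : β.moment [.Y, .X, .X] = β.moment [.X, .X, .Y] := β.cyclic _ _ ⟨1, rfl⟩
  have c10 : β.moment [.Y, .Y, .X, .X] = β.moment [.X, .X, .Y, .Y] := β.cyclic _ _ ⟨2, rfl⟩
  constructor <;> first | exact hnorm | linarith

/-- The kernel of a moment matrix of rank five is spanned by the two column relations. -/
theorem TracialSeq.eq_of_momentMatrix_mulVec_eq_zero {β : TracialSeq}
    (hrank : β.momentMatrix.rank = 5)
    (hXY : β.column [.X, .Y] + β.column [.Y, .X] = 0)
    (hXX : β.column [.X, .X] = β.column [.Y, .Y])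
    {v : Fin 7 → ℝ} (hv : β.momentMatrix *ᵥ v = 0) :
    v 0 = 0 ∧ v 1 = 0 ∧ v 3 = -v 6 := by
  set u₁ : Fin 7 → ℝ := ![0, 0, 0, 0, 1, 1, 0]
  set u₂ : Fin 7 → ℝ := ![0, 0, 0, 1, 0, 0, -1]
  set W := LinearMap.ker β.momentMatrix.mulVecLin
  have hW : Module.finrank ℝ W = 2 := by
    have := β.momentMatrix.mulVecLin.finrank_range_add_finrank_ker
    rw [show Module.finrank ℝ (LinearMap.range β.momentMatrix.mulVecLin) = 5 from hrank] at this
    simp only [Module.finrank_fintype_fun_eq_card, Fintype.card_fin] at this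
    change 5 + Module.finrank ℝ W = 7 at this
    omega
  have hu₁ : u₁ ∈ W := by
    rw [LinearMap.mem_ker, mulVecLin_apply]
    funext i
    have := congrFun hXY i
    simp only [mulVec, dotProduct, Fin.sum_univ_seven, u₁]
    simpa [momentMatrix, column, basisWord] using this
  have hu₂ : u₂ ∈ W := by
    rw [LinearMap.mem_ker, mulVecLin_apply]
    funext i
    have := sub_eq_zero.2 (congrFun hXX i)
    simp only [mulVec, dotProduct, Fin.sum_univ_seven, u₂]
    simpa [momentMatrix, column, basisWord, sub_eq_add_neg] using this
  have hli : LinearIndependent ℝ ![u₁, u₂] := by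
    rw [LinearIndependent.pair_iff]
    intro s t h
    have h4 := congrFun h 4
    have h3 := congrFun h 3
    simp [u₁, u₂] at h3 h4
    exact ⟨h4, h3⟩
  have hspan : Submodule.span ℝ {u₁, u₂} = W := by
    apply Submodule.eq_of_le_of_finrank_eq
    · rw [Submodule.span_le]
      rintro x (rfl | rfl)
      exacts [hu₁, hu₂]
    · have := finrank_span_eq_card hli
      rw [hW]
      rw [Matrix.range_cons_cons_empty] at this
      simpa using this
  have hvW : v ∈ Submodule.span ℝ {u₁, u₂} := by
    rw [hspan]
    exact hv
  obtain ⟨s, t, rfl⟩ := Submodule.mem_span_pair.1 hvW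
  simp [u₁, u₂]

theorem TracialSeq.isHermitian_momentMatrix (β : TracialSeq) : β.momentMatrix.IsHermitian := by
  ext i j
  refine β.star _ _ ?_
  simp [starMul]

/-! ### Representing measures and the column relations -/

/-- The value at an atom of the polynomial with coefficient vector `x`. -/
def Atom.evalPoly (a : Atom) (x : Fin 7 → ℝ) : Matrix (Fin a.size) (Fin a.size) ℝ :=
  ∑ j, x j • a.eval (basisWord j).1

theorem Atom.trace_evalPoly (a : Atom) (x : Fin 7 → ℝ) :
    ((a.evalPoly x)ᴴ * a.evalPoly x).trace =
      ∑ i, ∑ j, x i * x j * (a.eval (starMul (basisWord i) (basisWord j)).1).trace := by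
  simp only [evalPoly, starMul, eval_append, eval_reverse, conjTranspose_eq_transpose_of_trivial,
    transpose_sum, transpose_smul, Finset.sum_mul, Finset.mul_sum, trace_sum, smul_mul,
    Matrix.mul_smul, trace_smul, smul_eq_mul]
  rw [Finset.sum_comm]
  exact Finset.sum_congr rfl fun i _ => Finset.sum_congr rfl fun j _ => by ring

/-- This sum of nonnegative terms yields both positivity of the moment matrix and the transfer of
its kernel to the atoms. -/
theorem AtomicMeasure.Represents.quadraticForm {μ : AtomicMeasure} {β : TracialSeq}
    (h : μ.Represents β) (x : Fin 7 → ℝ) :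
    x ⬝ᵥ β.momentMatrix *ᵥ x = ∑ i, μ.density i *
      ((((μ.atom i).evalPoly x)ᴴ * (μ.atom i).evalPoly x).trace / (μ.atom i).size) := by
  simp only [Atom.trace_evalPoly, dotProduct, mulVec, TracialSeq.momentMatrix, of_apply,
    h _, Atom.normTrace, Finset.sum_div, Finset.mul_sum, Finset.sum_mul]
  rw [Finset.sum_comm (s := (Finset.univ : Finset (Fin μ.N)))]
  refine Finset.sum_congr rfl fun i _ => ?_
  rw [Finset.sum_comm (s := (Finset.univ : Finset (Fin μ.N)))]
  exact Finset.sum_congr rfl fun j _ => Finset.sum_congr rfl fun k _ => by ring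

theorem trace_conjTranspose_mul_self_nonneg {n : Type*} [Fintype n] (P : Matrix n n ℝ) :
    0 ≤ (Pᴴ * P).trace :=
  (posSemidef_conjTranspose_mul_self P).trace_nonneg

theorem AtomicMeasure.Represents.posSemidef {μ : AtomicMeasure} {β : TracialSeq}
    (h : μ.Represents β) : β.momentMatrix.PosSemidef := by
  refine PosSemidef.of_dotProduct_mulVec_nonneg β.isHermitian_momentMatrix fun x => ?_
  rw [star_trivial, h.quadraticForm]
  exact Finset.sum_nonneg fun i _ => mul_nonneg (μ.density_pos i).le
    (div_nonneg (trace_conjTranspose_mul_self_nonneg _) (Nat.cast_nonneg _))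

theorem AtomicMeasure.Represents.evalPoly_eq_zero {μ : AtomicMeasure} {β : TracialSeq}
    (h : μ.Represents β) {x : Fin 7 → ℝ} (hx : β.momentMatrix *ᵥ x = 0) (i : Fin μ.N) :
    (μ.atom i).evalPoly x = 0 := by
  have hq := h.quadraticForm x
  rw [hx, dotProduct_zero, eq_comm, Finset.sum_eq_zero_iff_of_nonneg fun i _ =>
    mul_nonneg (μ.density_pos i).le
      (div_nonneg (trace_conjTranspose_mul_self_nonneg _) (Nat.cast_nonneg _))] at hq
  have hi := hq i (Finset.mem_univ i)
  have hs : ((μ.atom i).size : ℝ) ≠ 0 := Nat.cast_ne_zero.2 (μ.atom i).size_pos.ne'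
  rcases mul_eq_zero.1 hi with h0 | h0
  · exact absurd h0 (μ.density_pos i).ne'
  · exact trace_conjTranspose_mul_self_eq_zero_iff.1 ((div_eq_zero_iff.1 h0).resolve_right hs)

/-- The atom satisfies `AB + BA = 0` and `A² = B²`. -/
def Atom.Relations (a : Atom) : Prop :=
  a.A * a.B + a.B * a.A = 0 ∧ a.A * a.A = a.B * a.B

theorem AtomicMeasure.Represents.relations {μ : AtomicMeasure} {β : TracialSeq}
    (h : μ.Represents β) (hXY : β.column [.X, .Y] + β.column [.Y, .X] = 0)
    (hXX : β.column [.X, .X] = β.column [.Y, .Y]) (i : Fin μ.N) : (μ.atom i).Relations := by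
  constructor
  · have := h.evalPoly_eq_zero (x := ![0, 0, 0, 0, 1, 1, 0]) (by
      funext k
      have := congrFun hXY k
      simp only [mulVec, dotProduct, Fin.sum_univ_seven]
      simpa [TracialSeq.momentMatrix, TracialSeq.column, basisWord] using this) i
    simpa [Atom.evalPoly, Fin.sum_univ_seven, basisWord, Atom.eval, Atom.letter] using this
  · have := h.evalPoly_eq_zero (x := ![0, 0, 0, 1, 0, 0, -1]) (by
      funext k
      have := sub_eq_zero.2 (congrFun hXX k)
      simp only [mulVec, dotProduct, Fin.sum_univ_seven]
      simpa [TracialSeq.momentMatrix, TracialSeq.column, basisWord, sub_eq_add_neg] using this) i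
    rw [← sub_eq_zero, sub_eq_add_neg]
    simpa [Atom.evalPoly, Fin.sum_univ_seven, basisWord, Atom.eval, Atom.letter] using this

namespace Atom

theorem Relations.trace_A {a : Atom} (h : a.Relations) : a.A.trace = 0 :=
  trace_eq_zero_of_anticommute a.A_symm h.1 h.2

theorem Relations.trace_B {a : Atom} (h : a.Relations) : a.B.trace = 0 :=
  trace_eq_zero_of_anticommute a.B_symm (by rw [add_comm, h.1]) h.2.symm

/-- The atom `(0, 0)` of size one. -/
def zero : Atom := ⟨1, one_pos, 0, 0, isSymm_zero, isSymm_zero⟩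

/-- The atom of size two given by two orthogonal reflections, scaled by `r`. -/
def reflections (r : ℝ) : Atom where
  size := 2
  size_pos := two_pos
  A := !![r, 0; 0, -r]
  B := !![0, r; r, 0]
  A_symm := by ext i j; fin_cases i <;> fin_cases j <;> rfl
  B_symm := by ext i j; fin_cases i <;> fin_cases j <;> rfl

theorem Relations.eq_zero_of_size_eq_one {a : Atom} (h : a.Relations) (ha : a.size = 1) :
    a = zero := by
  have hA := h.trace_A
  have hB := h.trace_B
  obtain ⟨n, hn, A, B, hAs, hBs⟩ := a
  obtain rfl : n = 1 := ha
  have hA' : A = 0 := by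
    ext i j
    fin_cases i; fin_cases j
    simpa [trace] using hA
  have hB' : B = 0 := by
    ext i j
    fin_cases i; fin_cases j
    simpa [trace] using hB
  subst hA' hB'
  rfl

end Atom

/-! ### Classification of the atoms of size two -/

/-- Traceless symmetric matrices of size two form a Euclidean plane, in which anticommuting means
orthogonal and equal squares mean equal lengths. So `B` is `A` turned by a right angle, in the
direction given by the sign `ε`. -/
theorem exists_entries_of_anticommute {A B : Matrix (Fin 2) (Fin 2) ℝ} (hA : A.IsSymm)
    (hB : B.IsSymm) (hAB : A * B + B * A = 0) (hsq : A * A = B * B) :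
    ∃ x y ε : ℝ, ε * ε = 1 ∧ A = !![x, y; y, -x] ∧ B = !![-(ε * y), ε * x; ε * x, ε * y] := by
  have hAt := trace_eq_zero_of_anticommute hA hAB hsq
  have hBt := trace_eq_zero_of_anticommute hB (by rw [add_comm, hAB]) hsq.symm
  have hA01 := hA.apply 0 1
  have hB01 := hB.apply 0 1
  rw [trace_fin_two] at hAt hBt
  have h1 := congrFun (congrFun hAB 0) 0
  have h2 := congrFun (congrFun hsq 0) 0
  simp only [Matrix.add_apply, mul_apply, Fin.sum_univ_two, Matrix.zero_apply] at h1 h2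
  rw [hA01, hB01] at h1
  rw [hA01, hB01] at h2
  have hA11 : A 1 1 = -A 0 0 := by linarith
  have hB11 : B 1 1 = -B 0 0 := by linarith
  have hAe := A.eta_fin_two
  have hBe := B.eta_fin_two
  rw [hA01, hA11] at hAe
  rw [hB01, hB11] at hBe
  generalize A 0 0 = x at *
  generalize A 0 1 = y at *
  generalize B 0 0 = u at *
  generalize B 0 1 = v at *
  rcases eq_or_ne (x * x + y * y) 0 with h0 | h0
  · have hu : u = 0 := by nlinarith [mul_self_nonneg u, mul_self_nonneg v]
    have hv : v = 0 := by nlinarith [mul_self_nonneg u, mul_self_nonneg v]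
    have hx : x = 0 := by nlinarith [mul_self_nonneg x, mul_self_nonneg y]
    have hy : y = 0 := by nlinarith [mul_self_nonneg x, mul_self_nonneg y]
    refine ⟨x, y, 1, by ring, hAe, ?_⟩
    rw [hBe, hu, hv, hx, hy]
    simp
  · have horth : x * u + y * v = 0 := by linarith
    -- The sign `ε` is the signed area spanned by the two vectors, divided by their common squared
    -- length.
    have e1 : (x * v - y * u) / (x * x + y * y) * x = v := by
      rw [div_mul_eq_mul_div, div_eq_iff h0]
      linear_combination -y * horth
    have e2 : (x * v - y * u) / (x * x + y * y) * y = -u := by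
      rw [div_mul_eq_mul_div, div_eq_iff h0]
      linear_combination x * horth
    refine ⟨x, y, (x * v - y * u) / (x * x + y * y), ?_, hAe, ?_⟩
    · rw [div_mul_div_comm, div_eq_one_iff_eq (mul_ne_zero h0 h0)]
      linear_combination -(x * x + y * y) * h2 - (x * u + y * v) * horth
    · rw [e1, e2, hBe, neg_neg]

theorem fin_two_ext {a b c d a' b' c' d' : ℝ} (ha : a = a') (hb : b = b') (hc : c = c')
    (hd : d = d') : !![a, b; c, d] = !![a', b'; c', d'] := by
  rw [ha, hb, hc, hd]

/-- A matrix of the form `r` times a reflection is the conjugate of `r` times a coordinate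
reflection by the rotation through half the angle. -/
theorem exists_half_angle {r x y : ℝ} (hr : 0 < r) (h : x * x + y * y = r * r) :
    ∃ p q : ℝ, p * p + q * q = 1 ∧ r * (p * p - q * q) = x ∧ r * (2 * p * q) = y := by
  -- The half angle is a complex square root of the unit number `(x + iy) / r`.
  obtain ⟨w, hw⟩ := IsAlgClosed.exists_eq_mul_self (⟨x / r, y / r⟩ : ℂ)
  have hre : x / r = w.re * w.re - w.im * w.im := congrArg Complex.re hw
  have him : y / r = w.re * w.im + w.im * w.re := congrArg Complex.im hw
  rw [div_eq_iff hr.ne'] at hre him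
  refine ⟨w.re, w.im, ?_, by rw [hre]; ring, by rw [him]; ring⟩
  have h1 : (w.re * w.re + w.im * w.im) ^ 2 = 1 := by
    apply mul_right_cancel₀ (mul_pos hr hr).ne'
    rw [hre, him] at h
    linear_combination h
  exact (pow_eq_one_iff_of_nonneg
    (add_nonneg (mul_self_nonneg _) (mul_self_nonneg _)) two_ne_zero).1 h1

namespace Atom

theorem zero_orthEquiv {a : Atom} (h : a.Relations) (ha : a.size = 1) : zero.OrthEquiv a := by
  rw [h.eq_zero_of_size_eq_one ha]
  exact ⟨1, by simp, by simp, by simp, by simp⟩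

/-- The conjugating matrix is the half-angle rotation times `diag(1, ε)`: the diagonal factor fixes
the first reflection and multiplies the second by `ε`, and the rotation then aligns the pair with
the atom. The moment hypothesis fixes the scale. -/
theorem reflections_orthEquiv {a : Atom} {r : ℝ} (hr : 0 < r) (h : a.Relations)
    (ha : a.size = 2) (htr : a.normTrace [.X, .X] = r * r) : (reflections r).OrthEquiv a := by
  obtain ⟨n, hn, A, B, hA, hB⟩ := a
  obtain rfl : n = 2 := ha
  obtain ⟨x, y, ε, hε, rfl, rfl⟩ := exists_entries_of_anticommute hA hB h.1 h.2
  have hxy : x * x + y * y = r * r := by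
    rw [← htr]
    simp [normTrace, eval, letter, trace_fin_two]
    ring
  obtain ⟨p, q, hpq, hx, hy⟩ := exists_half_angle hr hxy
  have hT : (!![p, -(ε * q); q, ε * p])ᵀ = !![p, q; -(ε * q), ε * p] := by
    ext i j
    fin_cases i <;> fin_cases j <;> rfl
  have hU₁ : (!![p, -(ε * q); q, ε * p])ᵀ * !![p, -(ε * q); q, ε * p] = 1 := by
    rw [hT, mul_fin_two, one_fin_two]
    apply fin_two_ext
    · linear_combination hpq
    · ring
    · ring
    · linear_combination (p * p + q * q) * hε + hpq
  have hU₂ : !![p, -(ε * q); q, ε * p] * (!![p, -(ε * q); q, ε * p])ᵀ = 1 := by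
    rw [hT, mul_fin_two, one_fin_two]
    apply fin_two_ext
    · linear_combination q * q * hε + hpq
    · linear_combination -p * q * hε
    · linear_combination -p * q * hε
    · linear_combination p * p * hε + hpq
  have hUA : !![x, y; y, -x] =
      !![p, -(ε * q); q, ε * p] * !![r, 0; 0, -r] * (!![p, -(ε * q); q, ε * p])ᵀ := by
    rw [hT, mul_fin_two, mul_fin_two]
    apply fin_two_ext
    · linear_combination -hx + r * q * q * hε
    · linear_combination -hy - r * p * q * hε
    · linear_combination -hy - r * p * q * hε
    · linear_combination hx + r * p * p * hε
  have hUB : !![-(ε * y), ε * x; ε * x, ε * y] =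
      !![p, -(ε * q); q, ε * p] * !![0, r; r, 0] * (!![p, -(ε * q); q, ε * p])ᵀ := by
    rw [hT, mul_fin_two, mul_fin_two]
    apply fin_two_ext
    · linear_combination ε * hy
    · linear_combination -ε * hx
    · linear_combination -ε * hx
    · linear_combination -ε * hy
  exact ⟨_, hU₁, hU₂, hUA, hUB⟩

/-- Here `A²` is the scalar matrix `s`, so its second moment fixes the fourth. -/
theorem Relations.exists_normTrace {a : Atom} (h : a.Relations) (ha : a.size = 2) :
    ∃ s, a.normTrace [.X, .X] = s ∧ a.normTrace [.X, .X, .X, .X] = s * s := by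
  obtain ⟨n, hn, A, B, hA, hB⟩ := a
  obtain rfl : n = 2 := ha
  obtain ⟨x, y, ε, hε, rfl, rfl⟩ := exists_entries_of_anticommute hA hB h.1 h.2
  refine ⟨x * x + y * y, ?_, ?_⟩ <;>
  · simp [normTrace, eval, letter, trace_fin_two]
    ring

end Atom

/-! ### The canonical measure -/

/-- The measure with an atom `(0, 0)` of density `1 - l` and an atom of size two of density `l`. -/
noncomputable def canonicalMeasure (r l : ℝ) (h0 : 0 < l) (h1 : l < 1) : AtomicMeasure where
  N := 2
  density := ![1 - l, l]
  density_pos := Fin.forall_fin_two.2 ⟨sub_pos.2 h1, h0⟩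
  density_sum := by simp
  atom := ![Atom.zero, Atom.reflections r]

section canonicalMeasure

variable {r l : ℝ} (h0 : 0 < l) (h1 : l < 1)

theorem canonicalMeasure_numAtoms (k : ℕ) : (canonicalMeasure r l h0 h1).numAtoms k =
    (if 1 = k then 1 else 0) + (if 2 = k then 1 else 0) := by
  rw [AtomicMeasure.numAtoms, Finset.card_filter]
  exact Fin.sum_univ_two _

theorem canonicalMeasure_maxSize : (canonicalMeasure r l h0 h1).maxSize = 2 := by
  refine le_antisymm (Finset.sup_le fun i _ => ?_)
    (Finset.le_sup (f := fun i => ((canonicalMeasure r l h0 h1).atom i).size)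
      (Finset.mem_univ (1 : Fin 2)))
  revert i
  exact Fin.forall_fin_two.2 ⟨fun _ => one_le_two, fun _ => le_rfl⟩

theorem canonicalMeasure_type : (canonicalMeasure r l h0 h1).type = [1, 1] := by
  simp [AtomicMeasure.type, canonicalMeasure_maxSize, canonicalMeasure_numAtoms, List.range_succ]

theorem canonicalMeasure_represents {β : TracialSeq} {a c : ℝ} (hβ : β.HasMoments a c)
    (hX : β.moment [.X] = 0) (hY : β.moment [.Y] = 0) (ha : l * (r * r) = a)
    (hc : l * (r * r * (r * r)) = c) : (canonicalMeasure r l h0 h1).Represents β := by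
  refine AtomicMeasure.represents_of_necklaces fun w hw => ?_
  have hsum : ∀ w, ∑ i, (canonicalMeasure r l h0 h1).density i *
      ((canonicalMeasure r l h0 h1).atom i).normTrace w =
      (1 - l) * Atom.zero.normTrace w + l * (Atom.reflections r).normTrace w :=
    fun w => Fin.sum_univ_two _
  rw [hsum]
  simp only [necklaces, List.mem_cons, List.not_mem_nil, or_false] at hw
  rcases hw with rfl | rfl | rfl | rfl | rfl | rfl | rfl | rfl | rfl | rfl | rfl | rfl | rfl | rfl |
    rfl | rfl
  all_goals
    simp only [hβ.one, hX, hY, hβ.XX, hβ.XY, hβ.YY, hβ.XXX, hβ.XXY, hβ.XYY, hβ.YYY, hβ.XXXX,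
      hβ.XXXY, hβ.XXYY, hβ.XYXY, hβ.XYYY, hβ.YYYY, ← ha, ← hc]
    unfold Atom.zero Atom.reflections
    simp [Atom.normTrace, Atom.eval, Atom.letter, trace_fin_two, h0.ne']
  all_goals ring

end canonicalMeasure

theorem AtomicMeasure.size_le_maxSize (μ : AtomicMeasure) (i : Fin μ.N) :
    (μ.atom i).size ≤ μ.maxSize :=
  Finset.le_sup (f := fun i => (μ.atom i).size) (Finset.mem_univ i)

theorem AtomicMeasure.numAtoms_eq_zero_of_maxSize_lt {μ : AtomicMeasure} {k : ℕ}
    (h : μ.maxSize < k) : μ.numAtoms k = 0 :=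
  Finset.card_eq_zero.2 (Finset.filter_eq_empty_iff.2 fun i _ =>
    ((μ.size_le_maxSize i).trans_lt h).ne)

/-! ### Sizes of the atoms of a representing measure -/

section sizes

variable {β : TracialSeq} {a c : ℝ} {ν : AtomicMeasure}

theorem Atom.Relations.normTrace_eq_zero {a : Atom} (h : a.Relations) (ha : a.size = 1)
    (l : Letter) (w : List Letter) : a.normTrace (l :: w) = 0 := by
  rw [h.eq_zero_of_size_eq_one ha]
  unfold Atom.zero
  cases l <;> simp [Atom.normTrace, Atom.eval, Atom.letter]

theorem AtomicMeasure.Represents.exists_size_ne_one (hν : ν.Represents β)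
    (hrel : ∀ i, (ν.atom i).Relations) (hβ : β.HasMoments a c) (hc : c ≠ 0) :
    ∃ i, (ν.atom i).size ≠ 1 := by
  by_contra! h
  refine hc ?_
  rw [← hβ.XXXX]
  exact (hν _).trans (Finset.sum_eq_zero fun i _ => by
    rw [(hrel i).normTrace_eq_zero (h i), mul_zero])

theorem AtomicMeasure.Represents.two_le_maxSize (hν : ν.Represents β)
    (hrel : ∀ i, (ν.atom i).Relations) (hβ : β.HasMoments a c) (hc : c ≠ 0) : 2 ≤ ν.maxSize := by
  obtain ⟨i, hi⟩ := hν.exists_size_ne_one hrel hβ hc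
  have h1 := (ν.atom i).size_pos
  have h2 := ν.size_le_maxSize i
  omega

theorem AtomicMeasure.Represents.numAtoms_two_ne_zero (hν : ν.Represents β)
    (hrel : ∀ i, (ν.atom i).Relations) (hβ : β.HasMoments a c) (hc : c ≠ 0)
    (hmax : ν.maxSize = 2) : ν.numAtoms 2 ≠ 0 := by
  obtain ⟨i, hi⟩ := hν.exists_size_ne_one hrel hβ hc
  have h1 := (ν.atom i).size_pos
  have h2 := ν.size_le_maxSize i
  exact Finset.card_ne_zero_of_mem (a := i) (by simp; omega)

/-- A single atom of size two cannot represent `β` unless `β_{X⁴} = β_{X²}²`. -/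
theorem AtomicMeasure.Represents.numAtoms_one_ne_zero (hν : ν.Represents β)
    (hrel : ∀ i, (ν.atom i).Relations) (hβ : β.HasMoments a c) (hac : c ≠ a * a)
    (hmax : ν.maxSize = 2) (h2 : ν.numAtoms 2 = 1) : ν.numAtoms 1 ≠ 0 := by
  intro h1
  have hsize : ∀ i, (ν.atom i).size = 2 := fun i => by
    have h3 := (ν.atom i).size_pos
    have h4 := ν.size_le_maxSize i
    have h5 : (ν.atom i).size ≠ 1 :=
      Finset.filter_eq_empty_iff.1 (Finset.card_eq_zero.1 h1) (Finset.mem_univ i)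
    omega
  obtain ⟨j, hj⟩ := Finset.card_eq_one.1 h2
  have huniv : (Finset.univ : Finset (Fin ν.N)) = {j} := by
    rw [← hj, eq_comm, Finset.filter_eq_self]
    exact fun i _ => hsize i
  have hdens := ν.density_sum
  rw [huniv, Finset.sum_singleton] at hdens
  have hmom : ∀ w (hw : w.length ≤ 4), β.moment w hw = (ν.atom j).normTrace w := fun w hw => by
    refine (hν ⟨w, hw⟩).trans ?_
    rw [huniv, Finset.sum_singleton, hdens, one_mul]
  obtain ⟨s, hs, hs'⟩ := (hrel j).exists_normTrace (hsize j)
  rw [← hmom _ (by decide), hβ.XX] at hs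
  rw [← hmom _ (by decide), hβ.XXXX] at hs'
  exact hac (by rw [hs', hs])

/-! ### Minimality and uniqueness of the canonical measure -/

theorem canonicalMeasure_isMinimal {r l : ℝ} (h0 : 0 < l) (h1 : l < 1)
    (hXY : β.column [.X, .Y] + β.column [.Y, .X] = 0)
    (hXX : β.column [.X, .X] = β.column [.Y, .Y]) (hβ : β.HasMoments a c) (hc : c ≠ 0)
    (hac : c ≠ a * a) (hrep : (canonicalMeasure r l h0 h1).Represents β) :
    (canonicalMeasure r l h0 h1).IsMinimal β := by
  refine ⟨hrep, ?_⟩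
  rintro ⟨ν, hν, hlt⟩
  have hrel := hν.relations hXY hXX
  have hge := hν.two_le_maxSize hrel hβ hc
  rw [AtomicMeasure.Smaller, canonicalMeasure_maxSize] at hlt
  rcases hlt with hlt | ⟨hmax, k, hk, hl⟩
  · omega
  have h2 := hν.numAtoms_two_ne_zero hrel hβ hc hmax
  simp only [canonicalMeasure_numAtoms] at hk hl
  -- The number of atoms can drop only at a size that occurs in the canonical measure.
  have hk2 : k = 1 ∨ k = 2 := by
    by_contra! hne
    rw [if_neg hne.1.symm, if_neg hne.2.symm] at hk
    omega
  rcases hk2 with rfl | rfl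
  · have := hν.numAtoms_one_ne_zero hrel hβ hac hmax (by simpa using hl 2 one_lt_two)
    simp at hk
    omega
  · simp at hk
    omega

/-- Every minimal representing measure has one atom of size one and one atom of size two, and no
others. -/
theorem AtomicMeasure.IsMinimal.exists_equiv {r l : ℝ} {h0 : 0 < l} {h1 : l < 1}
    (hν : ν.IsMinimal β) (hrel : ∀ i, (ν.atom i).Relations) (hβ : β.HasMoments a c) (hc : c ≠ 0)
    (hac : c ≠ a * a) (hrep : (canonicalMeasure r l h0 h1).Represents β) :
    ∃ e : Fin 2 ≃ Fin ν.N, (ν.atom (e 0)).size = 1 ∧ (ν.atom (e 1)).size = 2 := by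
  -- Comparison with the canonical measure bounds the type of `ν` from above; the moments bound it
  -- from below.
  have hnot : ¬ (canonicalMeasure r l h0 h1).Smaller ν := fun h => hν.2 ⟨_, hrep, h⟩
  rw [AtomicMeasure.Smaller, canonicalMeasure_maxSize] at hnot
  simp only [canonicalMeasure_numAtoms] at hnot
  push Not at hnot
  have hmax : ν.maxSize = 2 := le_antisymm hnot.1 (hν.1.two_le_maxSize hrel hβ hc)
  have hnot' := hnot.2 hmax.symm
  have hbig : ∀ k, 2 < k → ν.numAtoms k = 0 := fun k hk =>
    AtomicMeasure.numAtoms_eq_zero_of_maxSize_lt (hmax.trans_lt hk)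
  have h2 : ν.numAtoms 2 = 1 := by
    refine le_antisymm (le_of_not_gt fun hgt => ?_)
      (Nat.one_le_iff_ne_zero.2 (hν.1.numAtoms_two_ne_zero hrel hβ hc hmax))
    obtain ⟨k, hk, hne⟩ := hnot' 2 (by simpa using hgt)
    rw [hbig k hk, if_neg (by omega), if_neg (by omega)] at hne
    exact hne rfl
  have h1 : ν.numAtoms 1 = 1 := by
    refine le_antisymm (le_of_not_gt fun hgt => ?_)
      (Nat.one_le_iff_ne_zero.2 (hν.1.numAtoms_one_ne_zero hrel hβ hac hmax h2))
    obtain ⟨k, hk, hne⟩ := hnot' 1 (by simpa using hgt)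
    obtain rfl | hk : k = 2 ∨ 2 < k := by omega
    · exact hne (by simp [h2])
    · rw [hbig k hk, if_neg (by omega), if_neg (by omega)] at hne
      exact hne rfl
  obtain ⟨i, hi⟩ := Finset.card_eq_one.1 h1
  obtain ⟨j, hj⟩ := Finset.card_eq_one.1 h2
  have hi' : ∀ k, (ν.atom k).size = 1 ↔ k = i := fun k => by
    simpa using Finset.ext_iff.1 hi k
  have hj' : ∀ k, (ν.atom k).size = 2 ↔ k = j := fun k => by
    simpa using Finset.ext_iff.1 hj k
  have hsi := (hi' i).2 rfl
  have hsj := (hj' j).2 rfl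
  have hij : i ≠ j := by
    rintro rfl
    omega
  have hbij : Function.Bijective ![i, j] := by
    constructor
    · intro x y hxy
      fin_cases x <;> fin_cases y <;> simp_all
    · intro k
      have h3 := (ν.atom k).size_pos
      have h4 := ν.size_le_maxSize k
      obtain h5 | h5 : (ν.atom k).size = 1 ∨ (ν.atom k).size = 2 := by omega
      · exact ⟨0, ((hi' k).1 h5).symm⟩
      · exact ⟨1, ((hj' k).1 h5).symm⟩
  exact ⟨Equiv.ofBijective _ hbij, hsi, hsj⟩

/-- Only the atom of size two contributes to `a` and `c`. If its density is `l'` and its square is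
the scalar `s`, then `l' s = a` and `l' s² = c`, which force `s = r²` and `l' = l`. -/
theorem canonicalMeasure_orthEquiv {r l : ℝ} {h0 : 0 < l} {h1 : l < 1} (hr : 0 < r)
    (hν : ν.IsMinimal β) (hrel : ∀ i, (ν.atom i).Relations) (hβ : β.HasMoments a c) (hc : c ≠ 0)
    (hac : c ≠ a * a) (ha : l * (r * r) = a) (hc' : l * (r * r * (r * r)) = c)
    (hrep : (canonicalMeasure r l h0 h1).Represents β) :
    (canonicalMeasure r l h0 h1).OrthEquiv ν := by
  obtain ⟨e, he1, he2⟩ := hν.exists_equiv hrel hβ hc hac hrep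
  have hmom : ∀ w (hw : w.length ≤ 4), β.moment w hw =
      ν.density (e 0) * (ν.atom (e 0)).normTrace w +
        ν.density (e 1) * (ν.atom (e 1)).normTrace w := fun w hw => by
    refine (hν.1 ⟨w, hw⟩).trans ?_
    rw [← e.sum_comp, Fin.sum_univ_two]
  have hdens := ν.density_sum
  rw [← e.sum_comp, Fin.sum_univ_two] at hdens
  obtain ⟨s, hs, hs'⟩ := (hrel (e 1)).exists_normTrace he2
  have hma := hmom [.X, .X] (by decide)
  have hmc := hmom [.X, .X, .X, .X] (by decide)
  rw [hβ.XX, (hrel (e 0)).normTrace_eq_zero he1, hs, mul_zero, zero_add] at hma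
  rw [hβ.XXXX, (hrel (e 0)).normTrace_eq_zero he1, hs', mul_zero, zero_add] at hmc
  have hapos : a ≠ 0 := by
    rw [← ha]
    positivity
  have hsr : s = r * r := by
    apply mul_left_cancel₀ hapos
    rw [← ha] at hma ⊢
    linear_combination s * hma - hc' - hmc
  have hl : ν.density (e 1) = l := by
    apply mul_right_cancel₀ (mul_pos hr hr).ne'
    rw [ha, hma, hsr]
  refine ⟨e, Fin.forall_fin_two.2 ⟨⟨?_, ?_⟩, ?_, ?_⟩⟩
  · change ν.density (e 0) = 1 - l
    linarith
  · exact Atom.zero_orthEquiv (hrel _) he1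
  · exact hl
  · exact Atom.reflections_orthEquiv hr (hrel _) he2 (hs.trans hsr)

end sizes

/-! ### Strict positivity and existence of the measure -/

/-- The polynomials `X` and `X² - a` lie outside the kernel, which is spanned by `XY + YX` and `X² -
Y²`. The form takes the values `a` and `c - a²` on them. -/
theorem TracialSeq.HasMoments.pos {β : TracialSeq} {a c : ℝ} (hβ : β.HasMoments a c)
    (hrank : β.momentMatrix.rank = 5)
    (hXY : β.column [.X, .Y] + β.column [.Y, .X] = 0)
    (hXX : β.column [.X, .X] = β.column [.Y, .Y]) (hpsd : β.momentMatrix.PosSemidef) :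
    0 < a ∧ a * a < c := by
  have hker : ∀ x : Fin 7 → ℝ, β.momentMatrix *ᵥ x = 0 → x 0 = 0 ∧ x 1 = 0 ∧ x 3 = -x 6 :=
    fun x => TracialSeq.eq_of_momentMatrix_mulVec_eq_zero hrank hXY hXX
  have hpos : ∀ x : Fin 7 → ℝ, β.momentMatrix *ᵥ x ≠ 0 → 0 < x ⬝ᵥ β.momentMatrix *ᵥ x := by
    intro x hx
    refine lt_of_le_of_ne (hpsd.dotProduct_mulVec_nonneg x) fun h => hx ?_
    exact (hpsd.dotProduct_mulVec_zero_iff x).1 h.symm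
  constructor
  · have h := hpos (Pi.single 1 1) fun h => one_ne_zero (α := ℝ) (by simpa using (hker _ h).2.1)
    rw [mulVec_single_one, single_one_dotProduct] at h
    rw [← hβ.XX]
    exact h
  · have h := hpos (Pi.single 3 1 - Pi.single 0 a) fun h =>
      one_ne_zero (α := ℝ) (by simpa [Pi.single_apply] using (hker _ h).2.2)
    have e00 : β.momentMatrix 0 0 = 1 := hβ.one
    have e03 : β.momentMatrix 0 3 = a := hβ.XX
    have e30 : β.momentMatrix 3 0 = a := hβ.XX
    have e33 : β.momentMatrix 3 3 = c := hβ.XXXX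
    have : (Pi.single 3 1 - Pi.single 0 a : Fin 7 → ℝ) ⬝ᵥ
        β.momentMatrix *ᵥ (Pi.single 3 1 - Pi.single 0 a) = c - a * a := by
      simp [mulVec_sub, sub_dotProduct, dotProduct_sub, e00, e03, e30, e33]
    linarith

/-- The measure of type `(1, 1)` that represents `β`. -/
theorem TracialSeq.HasMoments.exists_measure {β : TracialSeq} {a c : ℝ} (hβ : β.HasMoments a c)
    (hXY : β.column [.X, .Y] + β.column [.Y, .X] = 0)
    (hXX : β.column [.X, .X] = β.column [.Y, .Y]) (ha : 0 < a) (hac : a * a < c)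
    (hX : β.moment [.X] = 0) (hY : β.moment [.Y] = 0) :
    ∃ μ : AtomicMeasure, μ.IsMinimal β ∧ μ.maxSize = 2 ∧ μ.type = [1, 1] ∧
      ∀ ν : AtomicMeasure, ν.IsMinimal β → μ.OrthEquiv ν := by
  have hc : 0 < c := (mul_pos ha ha).trans hac
  -- Solving `l r² = a` and `l r⁴ = c` gives `r² = c / a` and `l = a² / c`; the condition `l < 1` is
  -- exactly `a² < c`.
  have hr : 0 < √(c / a) := Real.sqrt_pos.2 (div_pos hc ha)
  have hrr : √(c / a) * √(c / a) = c / a := Real.mul_self_sqrt (div_pos hc ha).le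
  have h0 : 0 < a * a / c := div_pos (mul_pos ha ha) hc
  have h1 : a * a / c < 1 := (div_lt_one hc).2 hac
  have e1 : a * a / c * (√(c / a) * √(c / a)) = a := by
    rw [hrr]
    field_simp
  have e2 : a * a / c * (√(c / a) * √(c / a) * (√(c / a) * √(c / a))) = c := by
    rw [hrr]
    field_simp
  have hrep := canonicalMeasure_represents h0 h1 hβ hX hY e1 e2
  exact ⟨_, canonicalMeasure_isMinimal h0 h1 hXY hXX hβ hc.ne' hac.ne' hrep,
    canonicalMeasure_maxSize h0 h1, canonicalMeasure_type h0 h1, fun ν hν =>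
      canonicalMeasure_orthEquiv hr hν (hν.1.relations hXY hXX) hβ hc.ne' hac.ne' e1 e2 hrep⟩

theorem AtomicMeasure.Represents.moment_X_Y_eq_zero {μ : AtomicMeasure} {β : TracialSeq}
    (h : μ.Represents β) (hrel : ∀ i, (μ.atom i).Relations) :
    β.moment [.X] = 0 ∧ β.moment [.Y] = 0 := by
  constructor
  · refine (h _).trans (Finset.sum_eq_zero fun i _ => ?_)
    simp [Atom.normTrace, Atom.eval, Atom.letter, (hrel i).trace_A]
  · refine (h _).trans (Finset.sum_eq_zero fun i _ => ?_)
    simp [Atom.normTrace, Atom.eval, Atom.letter, (hrel i).trace_B]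

end BQTMP

theorem theorem6p13 (β : BQTMP.TracialSeq) (hnorm : β.Normalized) (hnc : β.Noncommutative)
    (hrank : β.momentMatrix.rank = 5)
    (hXY : β.column [.X, .Y] + β.column [.Y, .X] = 0)
    (hXX : β.column [.X, .X] = β.column [.Y, .Y]) :
    (β.AdmitsNcMeasure ↔
      β.momentMatrix.PosSemidef ∧ β.moment [.X] = 0 ∧ β.moment [.Y] = 0) ∧
    (β.AdmitsNcMeasure →
      ∃ μ : BQTMP.AtomicMeasure, μ.IsMinimal β ∧ μ.type = [1, 1] ∧
        ∀ ν : BQTMP.AtomicMeasure, ν.IsMinimal β → μ.OrthEquiv ν) := by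
  have hβ := BQTMP.TracialSeq.hasMoments hnorm hXY hXX
  have hnec : β.AdmitsNcMeasure →
      β.momentMatrix.PosSemidef ∧ β.moment [.X] = 0 ∧ β.moment [.Y] = 0 := by
    rintro ⟨μ, hμ, -⟩
    exact ⟨hμ.1.posSemidef, hμ.1.moment_X_Y_eq_zero (hμ.1.relations hXY hXX)⟩
  refine ⟨⟨hnec, ?_⟩, fun h => ?_⟩
  · rintro ⟨hpsd, hX, hY⟩
    obtain ⟨ha, hac⟩ := hβ.pos hrank hXY hXX hpsd
    obtain ⟨μ, hμ, hmax, -⟩ := hβ.exists_measure hXY hXX ha hac hX hY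
    exact ⟨μ, hμ, by omega⟩
  · obtain ⟨hpsd, hX, hY⟩ := hnec h
    obtain ⟨ha, hac⟩ := hβ.pos hrank hXY hXX hpsd
    obtain ⟨μ, hμ, -, htype, huniq⟩ := hβ.exists_measure hXY hXX ha hac hX hY
    exact ⟨μ, hμ, htype, huniq⟩
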